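/- Let $\mathcal{O}(\overline{D(0,1)}) \subset \mathbf{C}[[z]]$ denote the ring of power series that are Taylor series at $0$ of functions holomorphic on some open neighborhood of the closed unit disc $|z| \le 1$. Let $\mathbf{T} = \{ e^{2\pi i \theta} : \theta \in [0,1)\}$ be the unit circle with its normalized Haar measure $\mu_{\mathrm{Haar}} = d\theta$, and write $\log^+ r = \max(0, \log r)$, with $\log^+ 0 = 0$. Consider the following data: (i) a nonconstant rational function $p(x) \in \mathbf{Q}(x) \setminus \mathbf{Q}$ without pole at $x = 0$; (ii) a formal power series $x(t) \in t + t^2 \mathbf{Q}[[t]]$ such that $p(x(t)) \in \mathbf{Z}[[t]]$; (iii) a function $\varphi$ holomorphic on a neighborhood of the closed unit disc, with $\varphi(0) = 0$ and $|\varphi'(0)| > 1$, such that $p \circ \varphi$ is holomorphic on a neighborhood of the closed unit disc. Let $f_1, \ldots, f_m \in \mathbf{Q}[[x]]$ be formal power series that are linearly independent over the field $\mathbf{Q}(p(x))$ and such that, for every $i$, the formal composition $f_i(x(t))$ lies in $\mathbf{Z}[[t]]$ and the formal composition $f_i(\varphi(z))$ of $f_i$ with the Taylor series of $\varphi$ at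 $0$ lies in $\mathcal{O}(\overline{D(0,1)})$. Then $f_1, \ldots, f_m$ are all algebraic over $\mathbf{Q}(x)$, and $$ m \;\le\; e \cdot \frac{\int_{\mathbf{T}} \log^+ |p \circ \varphi| \, \mu_{\mathrm{Haar}}}{\log |\varphi'(0)|}, $$ where $e = 2.718\ldots$ is the base of the natural logarithm. -/

import Mathlib

open scoped PowerSeries LaurentSeries

/-- The Taylor series at `0` of a function `g : ℂ → ℂ`, as a formal power series. -/
noncomputable def taylorSeries (g : ℂ → ℂ) : ℂ⟦X⟧ :=
  PowerSeries.mk fun n => iteratedDeriv n g 0 / (n.factorial : ℂ)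

/-- Membership of a formal power series in `𝒪(closed unit disc) ⊆ ℂ⟦z⟧`: it is the Taylor series
at `0` of a function that is holomorphic on a neighbourhood of the closed unit disc. -/
def IsHolomorphicOnClosedDisc (F : ℂ⟦X⟧) : Prop :=
  ∃ g : ℂ → ℂ, AnalyticOnNhd ℂ g (Metric.closedBall 0 1) ∧ taylorSeries g = F

/-- A power series over `ℚ` all of whose coefficients are integers. -/
def HasIntegerCoeffs (F : ℚ⟦X⟧) : Prop :=
  ∀ n : ℕ, ∃ k : ℤ, PowerSeries.coeff n F = (k : ℚ)

/-!
Write `y = p(x)`. Linear independence over `ℚ(y)` makes the series `fᵢ yᵏ` linearly independent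
over `ℚ`. For large `d`, consider the nonzero integral combinations `F(x₁, …, x_d)` of the products
`∏ⱼ (f_{i_j} y^{k_j})(xⱼ)` with all `k_j < D`. These have `(m D)ᵈ` free coefficients, and there are
about `Nᵈ / d!` monomials of degree below `N`. Hence, for `N` slightly below `m D (d!)^(1/d)`, the
pigeonhole principle gives an `F` with small coefficients for which every Taylor coefficient of
`F(φ(z₁), …, φ(z_d)) ∏ⱼ W(zⱼ)` of degree below `N` is small.

Substituting `xⱼ = x(tⱼ)` shows that a nonzero coefficient of `F` of minimal degree `n` is an
integer, hence at least `1` in absolute value; in the variables `z` it is multiplied by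
`φ'(0)ⁿ W(0)ᵈ`, which rules out `n < N`. For `n ≥ N` Cauchy's estimate bounds the product by
`exp (ε D)`, provided that `|W| max(1, |p ∘ φ|)ᴰ ≤ 1` on the unit circle. With `W = exp(-D Q)`,
where `Re Q` is a harmonic majorant of `log⁺ |p ∘ φ|`, this reads
`N log |φ'(0)| ≤ d D Re Q(0) + ε D`, and `Re Q(0)` can be taken as close as desired to the mean of
`log⁺ |p ∘ φ|`. Since `d / (d!)^(1/d) → e`, the bound on `m` follows. The powers of an `fᵢ`
transcendental over `ℚ(y)` would violate it.
-/

section TensorPower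

open PowerSeries Finset

variable {R S ι : Type*} [CommRing R] [CommRing S] [Fintype ι] {d : ℕ}

/-- The coefficient of `x₁ ^ n₁ ⋯ x_d ^ n_d` in the power series
`∑ j, a j * b (j 1) (x₁) ⋯ b (j d) (x_d)` in `d` variables. These series, with integer `a j`, are
the candidates for the auxiliary function. -/
noncomputable def tensorCoeff (b : ι → R⟦X⟧) (a : (Fin d → ι) → R) (n : Fin d → ℕ) : R :=
  ∑ j, a j * ∏ s, coeff (n s) (b (j s))

theorem tensorCoeff_map (g : R →+* S) (b : ι → R⟦X⟧) (a : (Fin d → ι) → R) (n : Fin d → ℕ) :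
    tensorCoeff (fun i => map g (b i)) (fun j => g (a j)) n = g (tensorCoeff b a n) := by
  simp [tensorCoeff]

theorem tensorCoeff_cons (b : ι → R⟦X⟧) (a : (Fin (d + 1) → ι) → R) (k : ℕ) (n : Fin d → ℕ) :
    tensorCoeff b a (Fin.cons k n : Fin (d + 1) → ℕ) =
      ∑ i, tensorCoeff b (fun j => a (Fin.cons i j)) n * coeff k (b i) := by
  simp only [tensorCoeff, ← (Fin.consEquiv fun _ => ι).sum_comp, Fintype.sum_prod_type, sum_mul,
    Fin.consEquiv_apply, Fin.prod_univ_succ, Fin.cons_zero, Fin.cons_succ]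
  refine sum_congr rfl fun i _ => sum_congr rfl fun j _ => ?_
  rw [show (Fin.consEquiv fun _ => ι) (i, j) = Fin.cons i j from rfl]
  ring

theorem eq_zero_of_forall_tensorCoeff_eq_zero {b : ι → R⟦X⟧} (hb : LinearIndependent R b)
    {a : (Fin d → ι) → R} (h : ∀ n, tensorCoeff b a n = 0) : a = 0 := by
  induction d with
  | zero =>
    ext j
    simpa [tensorCoeff, Subsingleton.elim j default] using h 0
  | succ d ih =>
    have hslice (i : ι) : (fun j : Fin d → ι => a (Fin.cons i j)) = 0 := ih fun n => by
      refine Fintype.linearIndependent_iff.1 hb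
        (fun i => tensorCoeff b (fun j => a (Fin.cons i j)) n) (PowerSeries.ext fun k => ?_) i
      simpa [tensorCoeff_cons] using h (Fin.cons k n)
    ext j
    simpa using congrFun (hslice (j 0)) (Fin.tail j)

theorem exists_minimal_tensorCoeff_ne_zero {b : ι → R⟦X⟧} (hb : LinearIndependent R b)
    {a : (Fin d → ι) → R} (ha : a ≠ 0) :
    ∃ n, tensorCoeff b a n ≠ 0 ∧ ∀ l, ∑ s, l s < ∑ s, n s → tensorCoeff b a l = 0 := by
  have hne : {n | tensorCoeff b a n ≠ 0}.Nonempty := by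
    by_contra! h
    exact ha (eq_zero_of_forall_tensorCoeff_eq_zero hb fun n => by
      simpa using Set.eq_empty_iff_forall_notMem.1 h n)
  obtain ⟨n, hn, hmin⟩ := (measure fun n : Fin d → ℕ => ∑ s, n s).wf.has_min _ hne
  exact ⟨n, hn, fun l hl => not_not.1 fun h => hmin l h hl⟩

theorem coeff_pow_mul_of_lt {a : R⟦X⟧} (ha : constantCoeff a = 0) (W : R⟦X⟧) {n l : ℕ}
    (h : n < l) : coeff n (a ^ l * W) = 0 := by
  obtain ⟨c, rfl⟩ := X_dvd_iff.2 ha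
  rw [mul_pow, mul_assoc, coeff_X_pow_mul', if_neg h.not_ge]

theorem coeff_pow_mul_self {a : R⟦X⟧} (ha : constantCoeff a = 0) (W : R⟦X⟧) (n : ℕ) :
    coeff n (a ^ n * W) = coeff 1 a ^ n * constantCoeff W := by
  obtain ⟨c, rfl⟩ := X_dvd_iff.2 ha
  have hc : coeff 1 (X * c) = constantCoeff c := by simp
  rw [mul_pow, mul_assoc, coeff_X_pow_mul', if_pos le_rfl, Nat.sub_self, hc,
    coeff_zero_eq_constantCoeff_apply, map_mul, map_pow]

theorem norm_tensorCoeff_le {𝕜 : Type*} [NormedField 𝕜] {b : ι → 𝕜⟦X⟧} {a : (Fin d → ι) → 𝕜}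
    {C T : ℝ} (hb : ∀ i n, ‖coeff n (b i)‖ ≤ C) (ha : ∀ j, ‖a j‖ ≤ T) (n : Fin d → ℕ) :
    ‖tensorCoeff b a n‖ ≤ (Fintype.card ι : ℝ) ^ d * (T * C ^ d) := by
  have hterm (j : Fin d → ι) : ‖a j * ∏ s, coeff (n s) (b (j s))‖ ≤ T * C ^ d := by
    rw [norm_mul, norm_prod]
    gcongr
    · exact (norm_nonneg _).trans (ha j)
    · exact ha j
    · simpa using prod_le_prod (fun s _ => norm_nonneg _) fun s (_ : s ∈ univ) => hb (j s) (n s)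
  simpa [tensorCoeff] using norm_sum_le_of_le univ fun j _ => hterm j

variable [Algebra R S]

theorem coeff_subst_mul {y : S⟦X⟧} (hy : constantCoeff y = 0) (W : S⟦X⟧) (f : R⟦X⟧) (n : ℕ) :
    coeff n (f.subst y * W) =
      ∑ l ∈ range (n + 1), coeff n (y ^ l * W) * algebraMap R S (coeff l f) := by
  have hs : HasSubst y := HasSubst.of_constantCoeff_zero' hy
  have hf : f.subst y = y ^ (n + 1) * (mk fun i => coeff (i + (n + 1)) f).subst y +
      ∑ l ∈ range (n + 1), coeff l f • y ^ l := by
    conv_lhs => rw [eq_X_pow_mul_shift_add_trunc (n + 1) f]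
    rw [subst_add hs, subst_mul hs, subst_pow hs, subst_X hs, subst_coe hs,
      Polynomial.aeval_eq_sum_range' (natDegree_trunc_lt f n)]
    congr 1
    exact sum_congr rfl fun l hl => by rw [coeff_trunc, if_pos (mem_range.1 hl)]
  rw [hf, add_mul, map_add, mul_assoc, coeff_pow_mul_of_lt hy _ n.lt_succ_self, zero_add, sum_mul,
    map_sum]
  refine sum_congr rfl fun l _ => ?_
  rw [smul_mul_assoc, ← algebraMap_smul S, coeff_smul, smul_eq_mul, mul_comm]

theorem tensorCoeff_subst_mul {y : S⟦X⟧} (hy : constantCoeff y = 0) (W : S⟦X⟧) (b : ι → R⟦X⟧)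
    (a : (Fin d → ι) → R) (n : Fin d → ℕ) :
    tensorCoeff (fun i => (b i).subst y * W) (fun j => algebraMap R S (a j)) n =
      ∑ l ∈ Fintype.piFinset fun s => range (n s + 1),
        (∏ s, coeff (n s) (y ^ l s * W)) * algebraMap R S (tensorCoeff b a l) := by
  simp only [tensorCoeff, coeff_subst_mul hy, prod_univ_sum, mul_sum, map_sum, map_mul, map_prod,
    prod_mul_distrib]
  rw [sum_comm]
  exact sum_congr rfl fun l _ => sum_congr rfl fun j _ => mul_left_comm _ _ _

theorem tensorCoeff_subst_mul_of_minimal {y : S⟦X⟧} (hy : constantCoeff y = 0) (W : S⟦X⟧)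
    {b : ι → R⟦X⟧} {a : (Fin d → ι) → R} {n : Fin d → ℕ}
    (hmin : ∀ l, ∑ s, l s < ∑ s, n s → tensorCoeff b a l = 0) :
    tensorCoeff (fun i => (b i).subst y * W) (fun j => algebraMap R S (a j)) n =
      coeff 1 y ^ (∑ s, n s) * constantCoeff W ^ d * algebraMap R S (tensorCoeff b a n) := by
  rw [tensorCoeff_subst_mul hy, sum_eq_single_of_mem n (by simp)]
  · simp [coeff_pow_mul_self hy, prod_mul_distrib, prod_pow_eq_pow_sum]
  · intro l hl hne
    have hle : l ≤ n := fun s => Nat.lt_succ_iff.1 (mem_range.1 (Fintype.mem_piFinset.1 hl s))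
    rw [hmin l (Fintype.sum_strictMono (lt_of_le_of_ne hle hne)), map_zero, mul_zero]

end TensorPower

section SmallLinearForms

open Finset

variable {α β : Type*} [Fintype β]

theorem abs_sum_mul_le_of_sum_round_mul_eq_zero {A : β → ℝ} {a : β → ℤ} {S T : ℝ} (hS : 0 < S)
    (ha : ∀ j, |(a j : ℝ)| ≤ T) (h : ∑ j, round (S * A j) * a j = 0) :
    |∑ j, A j * a j| ≤ Fintype.card β * T / (2 * S) := by
  have hround : S * ∑ j, A j * a j = ∑ j, (S * A j - round (S * A j)) * a j := by
    have h' : ∑ j, (round (S * A j) : ℝ) * a j = 0 := mod_cast h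
    simp only [sub_mul, sum_sub_distrib, h', sub_zero, mul_sum, mul_assoc]
  have hbound : |S * ∑ j, A j * a j| ≤ Fintype.card β * (1 / 2 * T) := by
    have hterm (j : β) : |(S * A j - round (S * A j)) * a j| ≤ 1 / 2 * T := by
      rw [abs_mul]
      exact mul_le_mul (abs_sub_round _) (ha j) (abs_nonneg _) (by norm_num)
    rw [hround]
    refine (abs_sum_le_sum_abs _ _).trans ?_
    exact (sum_le_card_nsmul univ _ _ fun j _ => hterm j).trans_eq (by simp)
  rw [abs_mul, abs_of_pos hS] at hbound
  rw [le_div_iff₀ (by positivity)]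
  linarith

variable [Fintype α]

-- Siegel's lemma applied to the integer matrix obtained by rounding `S • A`.
theorem exists_int_vec_abs_sum_mul_le [Nonempty α] {A : α → β → ℝ} {K S : ℝ}
    (hA : ∀ i j, |A i j| ≤ K) (hS : 0 < S) (hSK : 1 ≤ S * K)
    (hlt : Fintype.card α < Fintype.card β) {T : ℝ}
    (hT : (Fintype.card β * (2 * (S * K))) ^
      ((Fintype.card α : ℝ) / (Fintype.card β - Fintype.card α)) = T) :
    ∃ a : β → ℤ, a ≠ 0 ∧ (∀ j, |(a j : ℝ)| ≤ T) ∧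
      ∀ i, |∑ j, A i j * a j| ≤ Fintype.card β * T / (2 * S) := by
  classical
  let Y : Matrix α β ℤ := fun i j => round (S * A i j)
  let _ := Matrix.seminormedAddCommGroup (m := α) (n := β) (α := ℤ)
  obtain ⟨a, ha, hYa, haY⟩ := Int.Matrix.exists_ne_zero_int_vec_norm_le Y hlt Fintype.card_pos
  have hlt' : (Fintype.card α : ℝ) < Fintype.card β := mod_cast hlt
  have hY : max 1 ‖Y‖ ≤ 2 * (S * K) := by
    refine max_le (by linarith) ((Matrix.norm_le_iff (by linarith)).2 fun i j => ?_)
    have hSA : |S * A i j| ≤ S * K := by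
      rw [abs_mul, abs_of_pos hS]
      exact mul_le_mul_of_nonneg_left (hA i j) hS.le
    rw [Int.norm_eq_abs]
    linarith [abs_sub_abs_le_abs_sub (Y i j : ℝ) (S * A i j), abs_sub_comm (Y i j : ℝ) (S * A i j),
      abs_sub_round (S * A i j)]
  have haT (j : β) : |(a j : ℝ)| ≤ T :=
    calc |(a j : ℝ)| = ‖a j‖ := (Int.norm_eq_abs _).symm
      _ ≤ ‖a‖ := norm_le_pi_norm a j
      _ ≤ _ := haY
      _ ≤ T := by
        rw [← hT]
        have := sub_pos.2 hlt'
        gcongr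
  refine ⟨a, ha, haT, fun i => abs_sum_mul_le_of_sum_round_mul_eq_zero hS haT ?_⟩
  simpa [Matrix.mulVec, dotProduct] using congrFun hYa i

theorem exists_int_vec_norm_sum_mul_le [Nonempty α] {B : α → β → ℂ} {K S κ : ℝ}
    (hB : ∀ i j, ‖B i j‖ ≤ K) (hS : 0 < S) (hSK : 1 ≤ S * K) (hκ : κ ≤ 1 / 2)
    (hcard : 2 * (Fintype.card α : ℝ) ≤ κ * Fintype.card β) {T : ℝ}
    (hT : (Fintype.card β * (2 * (S * K))) ^ (2 * κ) = T) :
    ∃ a : β → ℤ, a ≠ 0 ∧ (∀ j, |(a j : ℝ)| ≤ T) ∧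
      ∀ i, ‖∑ j, a j * B i j‖ ≤ Fintype.card β * T / S := by
  let A : α ⊕ α → β → ℝ := Sum.elim (fun i j => (B i j).re) fun i j => (B i j).im
  have hA : ∀ i j, |A i j| ≤ K
    | .inl i, j => (Complex.abs_re_le_norm _).trans (hB i j)
    | .inr i, j => (Complex.abs_im_le_norm _).trans (hB i j)
  have hα : (1 : ℝ) ≤ Fintype.card α := mod_cast (Fintype.card_pos : 0 < Fintype.card α)
  have hβ : (1 : ℝ) ≤ Fintype.card β := by
    rcases (Fintype.card β).eq_zero_or_pos with h | h
    · norm_num [h] at hcard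
      linarith
    · exact_mod_cast h
  have hle : 2 * (Fintype.card α : ℝ) ≤ Fintype.card β / 2 := by nlinarith
  have hlt : Fintype.card (α ⊕ α) < Fintype.card β := by
    rw [Fintype.card_sum, ← two_mul]
    exact_mod_cast (by linarith : 2 * (Fintype.card α : ℝ) < Fintype.card β)
  have hexp : (Fintype.card (α ⊕ α) : ℝ) / (Fintype.card β - Fintype.card (α ⊕ α)) ≤ 2 * κ := by
    rw [Fintype.card_sum, Nat.cast_add, ← two_mul, div_le_iff₀ (by linarith)]
    nlinarith
  obtain ⟨a, ha, haT, hsmall⟩ := exists_int_vec_abs_sum_mul_le hA hS hSK hlt rfl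
  have hTle : (Fintype.card β * (2 * (S * K))) ^ ((Fintype.card (α ⊕ α) : ℝ) /
      (Fintype.card β - Fintype.card (α ⊕ α))) ≤ T :=
    hT ▸ Real.rpow_le_rpow_of_exponent_le (by nlinarith) hexp
  refine ⟨a, ha, fun j => (haT j).trans hTle, fun i => ?_⟩
  calc ‖∑ j, a j * B i j‖
      ≤ |(∑ j, a j * B i j).re| + |(∑ j, a j * B i j).im| := Complex.norm_le_abs_re_add_abs_im _
    _ = |∑ j, A (.inl i) j * a j| + |∑ j, A (.inr i) j * a j| := by simp [A, mul_comm]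
    _ ≤ Fintype.card β * T / (2 * S) + Fintype.card β * T / (2 * S) := by
      gcongr <;> exact (hsmall _).trans (by gcongr)
    _ = Fintype.card β * T / S := by ring

end SmallLinearForms

section AuxiliaryFunction

open PowerSeries Finset

/-- The multi-indices `n : Fin d → ℕ` of total degree at most `α`, obtained by forgetting the first
entry of the multi-indices in `d + 1` variables of total degree exactly `α`. -/
def lowDegree (d α : ℕ) : Finset (Fin d → ℕ) :=
  ((univ : Finset (Fin (d + 1))).piAntidiag α).image Fin.tail

theorem mem_lowDegree {d α : ℕ} {n : Fin d → ℕ} (hn : ∑ s, n s ≤ α) : n ∈ lowDegree d α := by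
  refine mem_image.2 ⟨Fin.cons (α - ∑ s, n s) n, ?_, Fin.tail_cons _ _⟩
  simp [mem_piAntidiag, Fin.sum_univ_succ, Nat.sub_add_cancel hn]

theorem card_lowDegree_le (d α : ℕ) : #(lowDegree d α) ≤ (α + d).choose d := by
  refine card_image_le.trans (le_of_eq ?_)
  rw [← map_sym_eq_piAntidiag, card_map, sym_univ, card_univ, Sym.card_sym_eq_choose,
    Fintype.card_fin, show d + 1 + α - 1 = α + d by omega]
  exact Nat.choose_symm_add

theorem HasIntegerCoeffs.exists_map_eq {F : ℚ⟦X⟧} (hF : HasIntegerCoeffs F) :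
    ∃ G : ℤ⟦X⟧, map (Int.castRingHom ℚ) G = F := by
  choose c hc using hF
  exact ⟨mk c, PowerSeries.ext fun n => by simp [hc n]⟩

variable {ι : Type*} [Fintype ι] {b : ι → ℚ⟦X⟧} {x : ℚ⟦X⟧} {φ W : ℂ⟦X⟧} {d : ℕ}

theorem one_le_norm_tensorCoeff_of_minimal (hx0 : constantCoeff x = 0) (hx1 : coeff 1 x = 1)
    (hint : ∀ i, HasIntegerCoeffs ((b i).subst x)) {a : (Fin d → ι) → ℤ} {n : Fin d → ℕ}
    (hn : tensorCoeff b (fun j => (a j : ℚ)) n ≠ 0)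
    (hmin : ∀ l, ∑ s, l s < ∑ s, n s → tensorCoeff b (fun j => (a j : ℚ)) l = 0) :
    1 ≤ ‖((tensorCoeff b (fun j => (a j : ℚ)) n : ℚ) : ℂ)‖ := by
  choose G hG using fun i => (hint i).exists_map_eq
  have hcast : tensorCoeff b (fun j => (a j : ℚ)) n = (tensorCoeff G a n : ℤ) := by
    have hsubst := tensorCoeff_subst_mul_of_minimal hx0 1 hmin
    have hmap := tensorCoeff_map (Int.castRingHom ℚ) G a n
    simp only [mul_one, hx1, one_pow, map_one, one_mul, Algebra.algebraMap_self,
      RingHom.id_apply] at hsubst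
    rw [← hsubst]
    simpa [hG] using hmap
  rw [hcast] at hn ⊢
  rw [Rat.cast_intCast, Complex.norm_intCast]
  exact_mod_cast Int.one_le_abs (Int.cast_ne_zero.1 hn)

-- The leading coefficient is at least `‖constantCoeff W‖ ^ d` in norm, so it cannot occur in
-- low degree.
theorem pow_mul_pow_le_of_small_tensorCoeff (hb : LinearIndependent ℚ b)
    (hx0 : constantCoeff x = 0) (hx1 : coeff 1 x = 1)
    (hint : ∀ i, HasIntegerCoeffs ((b i).subst x)) (hφ0 : constantCoeff φ = 0)
    (hφ1 : 1 ≤ ‖coeff 1 φ‖) {C : ℝ} (hC : ∀ i n, ‖coeff n ((b i).subst φ * W)‖ ≤ C)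
    {α : ℕ} {T : ℝ} {a : (Fin d → ι) → ℤ} (ha : a ≠ 0) (haT : ∀ j, |(a j : ℝ)| ≤ T)
    (hsmall : ∀ n : Fin d → ℕ, ∑ s, n s ≤ α →
      ‖tensorCoeff (fun i => (b i).subst φ * W) (fun j => (a j : ℂ)) n‖
        < ‖constantCoeff W‖ ^ d) :
    ‖coeff 1 φ‖ ^ α * ‖constantCoeff W‖ ^ d ≤ (Fintype.card ι : ℝ) ^ d * (T * C ^ d) := by
  have ha' : (fun j => (a j : ℚ)) ≠ 0 := fun h => ha <| funext fun j => by
    simpa using congrFun h j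
  obtain ⟨n, hn, hmin⟩ := exists_minimal_tensorCoeff_ne_zero hb ha'
  have hlower : ‖coeff 1 φ‖ ^ (∑ s, n s) * ‖constantCoeff W‖ ^ d ≤
      ‖tensorCoeff (fun i => (b i).subst φ * W) (fun j => (a j : ℂ)) n‖ := by
    have hlead := tensorCoeff_subst_mul_of_minimal hφ0 W hmin
    simp only [map_intCast, eq_ratCast] at hlead
    rw [hlead, norm_mul, norm_mul, norm_pow, norm_pow]
    exact le_mul_of_one_le_right (by positivity)
      (one_le_norm_tensorCoeff_of_minimal hx0 hx1 hint hn hmin)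
  have hα : α ≤ ∑ s, n s := by
    by_contra! h
    exact (hlower.trans_lt (hsmall n h.le)).not_ge
      (le_mul_of_one_le_left (by positivity) (one_le_pow₀ hφ1))
  calc ‖coeff 1 φ‖ ^ α * ‖constantCoeff W‖ ^ d
      ≤ ‖coeff 1 φ‖ ^ (∑ s, n s) * ‖constantCoeff W‖ ^ d := by gcongr
    _ ≤ _ := hlower
    _ ≤ _ := norm_tensorCoeff_le hC (by simpa using haT) n

theorem exists_int_vec_norm_tensorCoeff_le {B : ι → ℂ⟦X⟧} {C S κ : ℝ}
    (hB : ∀ i n, ‖coeff n (B i)‖ ≤ C) (hS : 0 < S) (hSC : 1 ≤ S * C ^ d) (hκ : κ ≤ 1 / 2) {α : ℕ}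
    (hcard : 2 * ((α + d).choose d : ℝ) ≤ κ * (Fintype.card ι : ℝ) ^ d) {T : ℝ}
    (hT : ((Fintype.card ι : ℝ) ^ d * (2 * (S * C ^ d))) ^ (2 * κ) = T) :
    ∃ a : (Fin d → ι) → ℤ, a ≠ 0 ∧ (∀ j, |(a j : ℝ)| ≤ T) ∧ ∀ n : Fin d → ℕ, ∑ s, n s ≤ α →
      ‖tensorCoeff B (fun j => (a j : ℂ)) n‖ ≤ (Fintype.card ι : ℝ) ^ d * T / S := by
  classical
  have hcardfun : (Fintype.card (Fin d → ι) : ℝ) = (Fintype.card ι : ℝ) ^ d := by simp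
  have : Nonempty (lowDegree d α) := ⟨⟨0, mem_lowDegree (by simp)⟩⟩
  have hprod (n : lowDegree d α) (j : Fin d → ι) : ‖∏ s, coeff (n.1 s) (B (j s))‖ ≤ C ^ d := by
    rw [norm_prod]
    simpa using prod_le_prod (fun s _ => norm_nonneg _) fun s (_ : s ∈ univ) => hB (j s) (n.1 s)
  have hcard' : 2 * (Fintype.card (lowDegree d α) : ℝ) ≤ κ * Fintype.card (Fin d → ι) := by
    rw [hcardfun, Fintype.card_coe]
    refine le_trans ?_ hcard
    gcongr
    exact card_lowDegree_le d α
  obtain ⟨a, ha, haT, hsmall⟩ :=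
    exists_int_vec_norm_sum_mul_le hprod hS hSC hκ hcard' (hcardfun ▸ hT)
  exact ⟨a, ha, haT, fun n hn => by
    simpa only [tensorCoeff, hcardfun] using hsmall ⟨n, mem_lowDegree hn⟩⟩

theorem exists_int_vec_norm_tensorCoeff_lt_exp_neg [Nonempty ι] {B : ι → ℂ⟦X⟧} {C U κ : ℝ}
    (hB : ∀ i n, ‖coeff n (B i)‖ ≤ C) (hC1 : 1 ≤ C) (hU : 0 ≤ U) (hκ : κ ≤ 1 / 4) {α : ℕ}
    (hcard : 2 * ((α + d).choose d : ℝ) ≤ κ * (Fintype.card ι : ℝ) ^ d) {L : ℝ}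
    (hL : Real.log (2 * (Fintype.card ι * C) ^ d) = L) :
    ∃ a : (Fin d → ι) → ℤ, a ≠ 0 ∧ (∀ j, |(a j : ℝ)| ≤ Real.exp (2 * κ * (4 * L + 2 * U))) ∧
      ∀ n : Fin d → ℕ, ∑ s, n s ≤ α →
        ‖tensorCoeff B (fun j => (a j : ℂ)) n‖ < Real.exp (-U) := by
  have hN : (1 : ℝ) ≤ Fintype.card ι := mod_cast (Fintype.card_pos : 0 < Fintype.card ι)
  set N : ℝ := (Fintype.card ι : ℝ)
  have hNd : 1 ≤ N ^ d := one_le_pow₀ hN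
  have hNC : N ^ d ≤ (N * C) ^ d := by gcongr; exact le_mul_of_one_le_right (by positivity) hC1
  have hexpL : Real.exp L = 2 * (N * C) ^ d := hL ▸ Real.exp_log (by positivity)
  have hL0 : 0 ≤ L := hL ▸ Real.log_nonneg (by linarith)
  -- The exponent makes the bound `N ^ d * T / S` from Siegel's lemma smaller than `exp (-U)`.
  let S : ℝ := Real.exp (3 * L + 2 * U)
  set t : ℝ := 2 * κ * (4 * L + 2 * U) with ht
  have hT : (N ^ d * (2 * (S * C ^ d))) ^ (2 * κ) = Real.exp t := by
    have hbase : N ^ d * (2 * (S * C ^ d)) = Real.exp L * S := by rw [hexpL]; ring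
    rw [hbase, ← Real.exp_add, ← Real.exp_mul, ht]
    ring_nf
  have hlt : N ^ d * Real.exp t / S < Real.exp (-U) := by
    have htle : t ≤ 2 * L + U := by nlinarith
    rw [div_lt_iff₀ (Real.exp_pos _), ← Real.exp_add]
    calc N ^ d * Real.exp t < Real.exp L * Real.exp t := by gcongr; linarith
      _ ≤ _ := by rw [← Real.exp_add]; exact Real.exp_le_exp.2 (by linarith)
  obtain ⟨a, ha, haT, hsmall⟩ := exists_int_vec_norm_tensorCoeff_le hB (Real.exp_pos _)
    (one_le_mul_of_one_le_of_one_le (Real.one_le_exp (by positivity)) (one_le_pow₀ hC1))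
    (by linarith) hcard hT
  exact ⟨a, ha, haT, fun n hn => (hsmall n hn).trans_lt hlt⟩

theorem mul_log_le_of_choose_le [Nonempty ι] (hb : LinearIndependent ℚ b)
    (hx0 : constantCoeff x = 0) (hx1 : coeff 1 x = 1)
    (hint : ∀ i, HasIntegerCoeffs ((b i).subst x)) (hφ0 : constantCoeff φ = 0)
    (hφ1 : 1 ≤ ‖coeff 1 φ‖) {C V κ : ℝ} (hC : ∀ i n, ‖coeff n ((b i).subst φ * W)‖ ≤ C)
    (hC1 : 1 ≤ C) (hV : 0 ≤ V) (hW : ‖constantCoeff W‖ = Real.exp (-V)) (hκ : κ ≤ 1 / 4) {α : ℕ}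
    (hcard : 2 * ((α + d).choose d : ℝ) ≤ κ * (Fintype.card ι : ℝ) ^ d) :
    α * Real.log ‖coeff 1 φ‖ ≤
      (1 + 4 * κ) * (d * V) + 3 * Real.log (2 * (Fintype.card ι * C) ^ d) := by
  have hN : (1 : ℝ) ≤ Fintype.card ι := mod_cast (Fintype.card_pos : 0 < Fintype.card ι)
  have hNC : 1 ≤ (Fintype.card ι * C) ^ d := one_le_pow₀ (one_le_mul_of_one_le_of_one_le hN hC1)
  obtain ⟨a, ha, haT, hsmall⟩ := exists_int_vec_norm_tensorCoeff_lt_exp_neg hC hC1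
    (by positivity : 0 ≤ d * V) hκ hcard rfl
  set L : ℝ := Real.log (2 * (Fintype.card ι * C) ^ d)
  set t : ℝ := 2 * κ * (4 * L + 2 * (d * V)) with ht
  have hexpL : Real.exp L = 2 * (Fintype.card ι * C) ^ d := Real.exp_log (by positivity)
  have hL : 0 ≤ L := Real.log_nonneg (by linarith)
  have hWd : ‖constantCoeff W‖ ^ d = Real.exp (-(d * V)) := by
    rw [hW, ← Real.exp_nat_mul, mul_neg]
  have hvalue : ‖coeff 1 φ‖ ^ α * Real.exp (-(d * V)) ≤ Real.exp (L + t) :=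
    calc _ = ‖coeff 1 φ‖ ^ α * ‖constantCoeff W‖ ^ d := by rw [hWd]
      _ ≤ (Fintype.card ι : ℝ) ^ d * (Real.exp t * C ^ d) :=
        pow_mul_pow_le_of_small_tensorCoeff hb hx0 hx1 hint hφ0 hφ1 hC ha haT (by rwa [hWd])
      _ = (Fintype.card ι * C) ^ d * Real.exp t := by ring
      _ ≤ _ := by rw [Real.exp_add, hexpL]; gcongr; linarith
  have hlog := Real.log_le_log (by positivity) hvalue
  rw [Real.log_mul (by positivity) (by positivity), Real.log_pow, Real.log_exp, Real.log_exp]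
    at hlog
  have htle : t ≤ 2 * L + 4 * κ * (d * V) := by
    rw [ht]
    linarith [mul_le_mul_of_nonneg_right hκ hL]
  linarith

end AuxiliaryFunction

section Asymptotics

open Filter Topology PowerSeries

theorem tendsto_log_mul_pow_div_atTop {c C : ℝ} (hc : 0 < c) (hC : 0 < C) (d : ℕ) :
    Tendsto (fun y : ℝ => Real.log (c * (y * C) ^ d) / y) atTop (𝓝 0) := by
  have hlog : Tendsto (fun y : ℝ => Real.log y / y) atTop (𝓝 0) :=
    Real.isLittleO_log_id_atTop.tendsto_div_nhds_zero
  have hsum := (tendsto_const_nhds (x := Real.log c + d * Real.log C)).div_atTop tendsto_id |>.add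
    (hlog.const_mul (d : ℝ))
  rw [mul_zero, add_zero] at hsum
  refine hsum.congr' ?_
  filter_upwards [eventually_gt_atTop 0] with y hy
  rw [Real.log_mul hc.ne' (by positivity), Real.log_pow, Real.log_mul hy.ne' hC.ne', id]
  ring

theorem eventually_two_mul_choose_le {d : ℕ} {s κ : ℝ} (hs : 0 ≤ s)
    (h : 2 * (s ^ d / d.factorial) < κ) :
    ∀ᶠ y : ℝ in atTop, 2 * ((⌊s * y⌋₊ + d).choose d : ℝ) ≤ κ * y ^ d := by
  have hratio : Tendsto (fun y : ℝ => 2 * ((⌊s * y⌋₊ / y + d / y) ^ d / d.factorial)) atTop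
      (𝓝 (2 * ((s + 0) ^ d / d.factorial))) :=
    ((((tendsto_nat_floor_mul_div_atTop hs).add
      (tendsto_const_nhds.div_atTop tendsto_id)).pow d).div_const _).const_mul 2
  rw [add_zero] at hratio
  filter_upwards [hratio.eventually_lt_const h, eventually_gt_atTop 0] with y hlt hy
  calc 2 * ((⌊s * y⌋₊ + d).choose d : ℝ)
      ≤ 2 * (((⌊s * y⌋₊ + d : ℕ) : ℝ) ^ d / d.factorial) := by
        gcongr; exact Nat.choose_le_pow_div d _
    _ = 2 * ((⌊s * y⌋₊ / y + d / y) ^ d / d.factorial) * y ^ d := by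
        rw [← add_div, div_pow]; push_cast; field_simp
    _ ≤ κ * y ^ d := by gcongr

variable {ι : Type*} [Fintype ι] {b : ι × ℕ → ℚ⟦X⟧} {x : ℚ⟦X⟧} {φ : ℂ⟦X⟧} {W : ℕ → ℂ⟦X⟧} {C v : ℝ}

theorem card_mul_log_le_of_two_mul_pow_div_factorial_lt [Nonempty ι] (hb : LinearIndependent ℚ b)
    (hx0 : constantCoeff x = 0) (hx1 : coeff 1 x = 1)
    (hint : ∀ ik, HasIntegerCoeffs ((b ik).subst x)) (hφ0 : constantCoeff φ = 0)
    (hφ1 : 1 ≤ ‖coeff 1 φ‖) (hv : 0 ≤ v)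
    (hW : ∀ D : ℕ, ‖constantCoeff (W D)‖ = Real.exp (-(D * v)))
    (hC : ∀ D i k n, k < D → ‖coeff n ((b (i, k)).subst φ * W D)‖ ≤ C)
    {d : ℕ} {s κ : ℝ} (hs : 0 ≤ s) (hκ : κ ≤ 1 / 4) (h : 2 * (s ^ d / d.factorial) < κ) :
    Fintype.card ι * (s * Real.log ‖coeff 1 φ‖) ≤ (1 + 4 * κ) * (d * v) := by
  have hm : (0 : ℝ) < Fintype.card ι := mod_cast Fintype.card_pos
  set m : ℝ := (Fintype.card ι : ℝ)
  have hC' : 0 < max 1 C := lt_max_of_lt_left one_pos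
  have hy : Tendsto (fun D : ℕ => m * D) atTop atTop :=
    tendsto_natCast_atTop_atTop.const_mul_atTop hm
  have hineq : ∀ᶠ D : ℕ in atTop, ⌊s * (m * D)⌋₊ / (m * D) * Real.log ‖coeff 1 φ‖ ≤
      (1 + 4 * κ) * (d * v) / m + 3 * (Real.log (2 * (m * D * max 1 C) ^ d) / (m * D)) := by
    filter_upwards [hy.eventually (eventually_two_mul_choose_le hs h), eventually_gt_atTop 0]
      with D hcard hD
    have : NeZero D := ⟨hD.ne'⟩
    have hbD : LinearIndependent ℚ fun ik : ι × Fin D => b (ik.1, ik.2) :=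
      hb.comp (Prod.map id Fin.val) (Function.injective_id.prodMap Fin.val_injective)
    have hcardD : (Fintype.card (ι × Fin D) : ℝ) = m * D := by simp [m]
    have hfinite := mul_log_le_of_choose_le (C := max 1 C) hbD hx0 hx1 (fun ik => hint _) hφ0 hφ1
      (fun ik n => (hC D ik.1 ik.2 n ik.2.2).trans (le_max_right _ _)) (le_max_left _ _)
      (by positivity) (hW D) hκ (by rwa [hcardD])
    rw [hcardD] at hfinite
    have : (0 : ℝ) < D := mod_cast hD
    rw [div_mul_eq_mul_div, div_le_iff₀ (by positivity)]
    refine hfinite.trans_eq ?_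
    field_simp
  have hlim := le_of_tendsto_of_tendsto
    (((tendsto_nat_floor_mul_div_atTop hs).comp hy).mul_const (Real.log ‖coeff 1 φ‖))
    ((((tendsto_log_mul_pow_div_atTop two_pos hC' d).comp hy).const_mul 3).const_add _) hineq
  rwa [mul_zero, add_zero, le_div_iff₀' hm] at hlim

theorem pow_mul_div_exp_one_div_factorial_le {r : ℝ} (hr : 0 ≤ r) (d : ℕ) :
    (r * (d / Real.exp 1)) ^ d / d.factorial ≤ r ^ d :=
  calc (r * (d / Real.exp 1)) ^ d / d.factorial
      = r ^ d * ((d : ℝ) ^ d / d.factorial / Real.exp d) := by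
        rw [mul_pow, div_pow, ← Real.exp_nat_mul, mul_one]; ring
    _ ≤ r ^ d * 1 := by
        gcongr
        exact (div_le_one (Real.exp_pos _)).2 (Real.pow_div_factorial_le_exp _ (by positivity) d)
    _ = r ^ d := mul_one _

theorem le_exp_one_mul_of_forall_two_mul_pow_div_factorial_lt {A : ℝ}
    (h : ∀ (d : ℕ) (s κ : ℝ), 0 ≤ s → κ ≤ 1 / 4 → 2 * (s ^ d / d.factorial) < κ →
      s * A ≤ (1 + 4 * κ) * (d * v)) :
    A ≤ Real.exp 1 * v := by
  have hrκ {r κ : ℝ} (hr0 : 0 ≤ r) (hr1 : r < 1) (hκ0 : 0 < κ) (hκ : κ ≤ 1 / 4) :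
      r * A ≤ (1 + 4 * κ) * (Real.exp 1 * v) := by
    obtain ⟨d, hd, hdpos⟩ := ((tendsto_pow_atTop_nhds_zero_of_lt_one hr0 hr1).eventually_lt_const
      (half_pos hκ0) |>.and (eventually_gt_atTop 0)).exists
    have hbound := h d (r * (d / Real.exp 1)) κ (by positivity) hκ
      (by linarith [pow_mul_div_exp_one_div_factorial_le hr0 d])
    have hd' : 0 < d / Real.exp 1 := by positivity
    refine le_of_mul_le_mul_left (le_of_eq_of_le ?_ (hbound.trans_eq ?_)) hd'
    · ring
    · field_simp
  have hr {r : ℝ} (hr0 : 0 ≤ r) (hr1 : r < 1) : r * A ≤ Real.exp 1 * v := by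
    have hlim : Tendsto (fun κ : ℝ => (1 + 4 * κ) * (Real.exp 1 * v)) (𝓝[>] 0)
        (𝓝 (Real.exp 1 * v)) :=
      (Continuous.tendsto' (by fun_prop) _ _ (by simp)).mono_left nhdsWithin_le_nhds
    refine ge_of_tendsto hlim ?_
    filter_upwards [Ioc_mem_nhdsGT (by norm_num : (0 : ℝ) < 1 / 4)] with κ hκ
    exact hrκ hr0 hr1 hκ.1 hκ.2
  have hlim : Tendsto (fun r : ℝ => r * A) (𝓝[<] 1) (𝓝 A) :=
    (Continuous.tendsto' (by fun_prop) _ _ (by simp)).mono_left nhdsWithin_le_nhds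
  refine le_of_tendsto hlim ?_
  filter_upwards [Ico_mem_nhdsLT one_pos] with r hr'
  exact hr hr'.1 hr'.2

theorem card_mul_log_le_exp_one_mul (hb : LinearIndependent ℚ b)
    (hx0 : constantCoeff x = 0) (hx1 : coeff 1 x = 1)
    (hint : ∀ ik, HasIntegerCoeffs ((b ik).subst x)) (hφ0 : constantCoeff φ = 0)
    (hφ1 : 1 ≤ ‖coeff 1 φ‖) (hv : 0 ≤ v)
    (hW : ∀ D : ℕ, ‖constantCoeff (W D)‖ = Real.exp (-(D * v)))
    (hC : ∀ D i k n, k < D → ‖coeff n ((b (i, k)).subst φ * W D)‖ ≤ C) :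
    Fintype.card ι * Real.log ‖coeff 1 φ‖ ≤ Real.exp 1 * v := by
  cases isEmpty_or_nonempty ι
  · simpa using by positivity
  · refine le_exp_one_mul_of_forall_two_mul_pow_div_factorial_lt fun d s κ hs hκ h => ?_
    rw [mul_left_comm]
    exact card_mul_log_le_of_two_mul_pow_div_factorial_lt hb hx0 hx1 hint hφ0 hφ1 hv hW hC hs hκ h

end Asymptotics

section TaylorSeries

open PowerSeries Metric

theorem coeff_taylorSeries (g : ℂ → ℂ) (n : ℕ) :
    coeff n (taylorSeries g) = iteratedDeriv n g 0 / (n.factorial : ℂ) :=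
  coeff_mk n _

theorem constantCoeff_taylorSeries (g : ℂ → ℂ) : constantCoeff (taylorSeries g) = g 0 := by
  simp [← coeff_zero_eq_constantCoeff_apply, coeff_taylorSeries]

theorem coeff_one_taylorSeries (g : ℂ → ℂ) : coeff 1 (taylorSeries g) = deriv g 0 := by
  simp [coeff_taylorSeries, iteratedDeriv_one]

theorem taylorSeries_congr {g h : ℂ → ℂ} (hgh : g =ᶠ[nhds 0] h) :
    taylorSeries g = taylorSeries h := by
  ext n
  rw [coeff_taylorSeries, coeff_taylorSeries, hgh.iteratedDeriv_eq]

theorem taylorSeries_const (c : ℂ) : taylorSeries (fun _ => c) = C c := by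
  ext n
  rcases eq_or_ne n 0 with rfl | h <;> simp [coeff_taylorSeries, iteratedDeriv_const, coeff_C, *]

variable {g h : ℂ → ℂ}

theorem taylorSeries_add (hg : AnalyticAt ℂ g 0) (hh : AnalyticAt ℂ h 0) :
    taylorSeries (fun z => g z + h z) = taylorSeries g + taylorSeries h := by
  ext n
  rw [map_add, coeff_taylorSeries, coeff_taylorSeries, coeff_taylorSeries,
    iteratedDeriv_fun_add hg.contDiffAt hh.contDiffAt, add_div]

theorem taylorSeries_mul (hg : AnalyticAt ℂ g 0) (hh : AnalyticAt ℂ h 0) :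
    taylorSeries (fun z => g z * h z) = taylorSeries g * taylorSeries h := by
  ext n
  rw [coeff_taylorSeries, coeff_mul, iteratedDeriv_fun_mul hg.contDiffAt hh.contDiffAt,
    Finset.Nat.sum_antidiagonal_eq_sum_range_succ_mk, Finset.sum_div]
  refine Finset.sum_congr rfl fun i hi => ?_
  rw [coeff_taylorSeries, coeff_taylorSeries,
    Nat.cast_choose ℂ (Nat.lt_succ_iff.1 (Finset.mem_range.1 hi))]
  have := n.factorial_ne_zero
  field_simp

theorem taylorSeries_pow (hg : AnalyticAt ℂ g 0) (k : ℕ) :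
    taylorSeries (fun z => g z ^ k) = taylorSeries g ^ k := by
  induction k with
  | zero => simpa using taylorSeries_const 1
  | succ k ih => simp only [pow_succ, taylorSeries_mul (hg.fun_pow k) hg, ih]

theorem taylorSeries_aeval {R : Type*} [CommSemiring R] [Algebra R ℂ] (hg : AnalyticAt ℂ g 0)
    (P : Polynomial R) :
    taylorSeries (fun z => Polynomial.aeval (g z) P) = Polynomial.aeval (taylorSeries g) P := by
  induction P using Polynomial.induction_on' with
  | add P Q hP hQ =>
    simp only [map_add, taylorSeries_add (hg.aeval_polynomial P) (hg.aeval_polynomial Q), hP, hQ]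
  | monomial n a =>
    simp only [Polynomial.aeval_monomial, taylorSeries_mul analyticAt_const (hg.fun_pow n),
      taylorSeries_pow hg, taylorSeries_const, PowerSeries.algebraMap_apply]

theorem norm_coeff_taylorSeries_le {R C : ℝ} (hR : 0 < R) (hg : DiffContOnCl ℂ g (ball 0 R))
    (hC : ∀ z ∈ sphere (0 : ℂ) R, ‖g z‖ ≤ C) (n : ℕ) :
    ‖coeff n (taylorSeries g)‖ ≤ C / R ^ n := by
  rw [coeff_taylorSeries, norm_div, Complex.norm_natCast, div_le_iff₀' (by positivity),
    ← mul_div_assoc]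
  exact Complex.norm_iteratedDeriv_le_of_forall_mem_sphere_norm_le n hR hg hC

theorem IsHolomorphicOnClosedDisc.pow {F : ℂ⟦X⟧} (hF : IsHolomorphicOnClosedDisc F) (k : ℕ) :
    IsHolomorphicOnClosedDisc (F ^ k) := by
  obtain ⟨g, hg, rfl⟩ := hF
  exact ⟨fun z => g z ^ k, hg.fun_pow k, taylorSeries_pow (hg 0 (by simp)) k⟩

end TaylorSeries

section HarmonicMajorant

open Metric Real PowerSeries
open scoped ComplexConjugate

theorem fourier_natCast_eq_circleMap_pow (k : ℕ) (t : ℝ) :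
    fourier (k : ℤ) (t : AddCircle (2 * π)) = circleMap 0 1 t ^ k := by
  have : (π : ℂ) ≠ 0 := mod_cast pi_ne_zero
  rw [fourier_coe_apply, circleMap_zero, Complex.ofReal_one, one_mul, ← Complex.exp_nat_mul]
  congr 1
  push_cast
  field_simp

theorem exists_polynomial_add_conj_eq {g : C(AddCircle (2 * π), ℂ)}
    (hg : g ∈ Submodule.span ℂ (Set.range (@fourier (2 * π)))) :
    ∃ P Q : Polynomial ℂ, ∀ t : ℝ,
      g t = P.eval (circleMap 0 1 t) + conj (Q.eval (circleMap 0 1 t)) := by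
  induction hg using Submodule.span_induction with
  | mem g hg =>
    obtain ⟨n, rfl⟩ := hg
    obtain ⟨k, rfl | rfl⟩ := n.eq_nat_or_neg
    · exact ⟨.X ^ k, 0, fun t => by rw [fourier_natCast_eq_circleMap_pow]; simp⟩
    · exact ⟨0, .X ^ k, fun t => by rw [fourier_neg, fourier_natCast_eq_circleMap_pow]; simp⟩
  | zero => exact ⟨0, 0, fun t => by simp⟩
  | add g h _ _ hg hh =>
    obtain ⟨P, Q, hPQ⟩ := hg
    obtain ⟨P', Q', hPQ'⟩ := hh
    exact ⟨P + P', Q + Q', fun t => by simp [hPQ, hPQ']; ring⟩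
  | smul c g _ hg =>
    obtain ⟨P, Q, hPQ⟩ := hg
    exact ⟨.C c * P, .C (conj c) * Q, fun t => by simp [hPQ]; ring⟩

variable {u : ℂ → ℝ} {ε : ℝ}

theorem exists_polynomial_abs_sub_re_le (hu : ContinuousOn u (sphere 0 1)) (hε : 0 < ε) :
    ∃ P : Polynomial ℂ, ∀ z ∈ sphere (0 : ℂ) 1, |u z - (P.eval z).re| ≤ ε := by
  have : Fact (0 < 2 * π) := ⟨two_pi_pos⟩
  let g₀ : C(AddCircle (2 * π), ℂ) := ⟨fun t => (u (AddCircle.toCircle t) : ℂ),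
    Complex.continuous_ofReal.comp <| hu.comp_continuous
      (continuous_subtype_val.comp AddCircle.continuous_toCircle)
      fun t => mem_sphere_zero_iff_norm.2 (Circle.norm_coe _)⟩
  have hg₀ : g₀ ∈ (Submodule.span ℂ (Set.range (@fourier (2 * π)))).topologicalClosure := by
    rw [span_fourier_closure_eq_top]
    trivial
  obtain ⟨g, hg, hdist⟩ := Metric.mem_closure_iff.1 hg₀ ε hε
  obtain ⟨P, Q, hPQ⟩ := exists_polynomial_add_conj_eq hg
  refine ⟨P + Q, fun z hz => ?_⟩
  obtain ⟨t, rfl⟩ : z ∈ Set.range (circleMap 0 1) := by simpa using hz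
  have hg₀t : g₀ t = (u (circleMap 0 1 t) : ℂ) := by
    simp [g₀, AddCircle.toCircle_apply_mk, circleMap_zero]
  calc |u (circleMap 0 1 t) - ((P + Q).eval (circleMap 0 1 t)).re|
      = |(g₀ t - g t).re| := by simp [hg₀t, hPQ]
    _ ≤ ‖g₀ t - g t‖ := Complex.abs_re_le_norm _
    _ ≤ dist g₀ g := by rw [← dist_eq_norm]; exact ContinuousMap.dist_apply_le_dist _
    _ ≤ ε := hdist.le

theorem circleAverage_re_eval (P : Polynomial ℂ) (c : ℂ) (R : ℝ) :
    circleAverage (fun z => (P.eval z).re) c R = (P.eval c).re := by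
  have hint : CircleIntegrable (fun z => P.eval z) c R :=
    P.continuous.continuousOn.circleIntegrable'
  have hre := Complex.reCLM.circleAverage_comp_comm hint
  rw [DiffContOnCl.circleAverage P.differentiable.diffContOnCl] at hre
  exact hre

theorem exists_polynomial_re_majorant (hu : ContinuousOn u (sphere 0 1)) (hε : 0 < ε) :
    ∃ Q : Polynomial ℂ, (∀ z ∈ sphere (0 : ℂ) 1, u z ≤ (Q.eval z).re) ∧
      (Q.eval 0).re ≤ circleAverage u 0 1 + ε := by
  obtain ⟨P, hP⟩ := exists_polynomial_abs_sub_re_le hu (half_pos hε)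
  have hre (z : ℂ) : ((P + .C ((ε / 2 : ℝ) : ℂ)).eval z).re = (P.eval z).re + ε / 2 := by
    rw [Polynomial.eval_add, Polynomial.eval_C, Complex.add_re, Complex.ofReal_re]
  have hui : CircleIntegrable u 0 1 := hu.circleIntegrable zero_le_one
  refine ⟨P + .C ((ε / 2 : ℝ) : ℂ), fun z hz => ?_, ?_⟩
  · rw [hre]
    linarith [(abs_le.1 (hP z hz)).2]
  · have hadd : circleAverage u 0 1 + ε = circleAverage (fun z => u z + ε) 0 1 := by
      rw [circleAverage_fun_add hui (circleIntegrable_const _ _ _), circleAverage_const]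
    rw [← circleAverage_re_eval _ 0 1, hadd]
    refine circleAverage_mono ?_ (hui.add (circleIntegrable_const _ _ _)) fun z hz => ?_
    · exact (Complex.continuous_re.comp (Polynomial.continuous _)).continuousOn.circleIntegrable
        zero_le_one
    · rw [hre]
      linarith [(abs_le.1 (hP z (by simpa using hz))).1]

theorem norm_pow_mul_exp_le_one {w Q : ℂ} (h : posLog ‖w‖ ≤ Q.re) {k D : ℕ} (hk : k ≤ D) :
    ‖w ^ k * Complex.exp (-(D * Q))‖ ≤ 1 := by
  have hmax : max 1 ‖w‖ ≤ exp Q.re := by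
    rwa [posLog_eq_log_max_one (norm_nonneg w), log_le_iff_le_exp (by positivity)] at h
  have hre : (-(D * Q) : ℂ).re = -(D * Q.re) := by simp
  rw [norm_mul, norm_pow, Complex.norm_exp, hre, exp_neg, ← div_eq_mul_inv,
    div_le_one (exp_pos _), exp_nat_mul]
  calc ‖w‖ ^ k ≤ max 1 ‖w‖ ^ k := by gcongr; exact le_max_right _ _
    _ ≤ max 1 ‖w‖ ^ D := pow_le_pow_right₀ (le_max_left _ _) hk
    _ ≤ exp Q.re ^ D := by gcongr

theorem norm_coeff_mul_pow_mul_taylorSeries_exp_le {g q : ℂ → ℂ} {C : ℝ}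
    (hg : AnalyticOnNhd ℂ g (closedBall 0 1)) (hgC : ∀ z ∈ sphere (0 : ℂ) 1, ‖g z‖ ≤ C)
    (hq : AnalyticOnNhd ℂ q (closedBall 0 1)) {Q : Polynomial ℂ}
    (hQ : ∀ z ∈ sphere (0 : ℂ) 1, posLog ‖q z‖ ≤ (Q.eval z).re) {k D : ℕ} (hk : k ≤ D) (n : ℕ) :
    ‖coeff n (taylorSeries g * taylorSeries q ^ k *
      taylorSeries fun z => Complex.exp (-(D * Q.eval z)))‖ ≤ C := by
  have hexp : AnalyticOnNhd ℂ (fun z => Complex.exp (-(D * Q.eval z))) (closedBall 0 1) :=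
    fun z _ => by
      have := Q.differentiable.analyticAt z
      fun_prop
  have hqk : AnalyticOnNhd ℂ (fun z => q z ^ k) (closedBall 0 1) := hq.fun_pow k
  have hprod : AnalyticOnNhd ℂ (fun z => q z ^ k * Complex.exp (-(D * Q.eval z)))
      (closedBall 0 1) := fun z hz => (hqk z hz).fun_mul (hexp z hz)
  have hgprod : AnalyticOnNhd ℂ (fun z => g z * (q z ^ k * Complex.exp (-(D * Q.eval z))))
      (closedBall 0 1) := fun z hz => (hg z hz).fun_mul (hprod z hz)
  have h0 : (0 : ℂ) ∈ closedBall (0 : ℂ) 1 := by simp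
  rw [mul_assoc, ← taylorSeries_pow (hq 0 h0), ← taylorSeries_mul (hqk 0 h0) (hexp 0 h0),
    ← taylorSeries_mul (hg 0 h0) (hprod 0 h0)]
  have hdiff :=
    (hgprod.differentiableOn.mono (closure_ball_subset_closedBall (x := 0))).diffContOnCl
  have hbound (z : ℂ) (hz : z ∈ sphere (0 : ℂ) 1) :
      ‖g z * (q z ^ k * Complex.exp (-(D * Q.eval z)))‖ ≤ C := by
    rw [norm_mul]
    exact (mul_le_of_le_one_right (norm_nonneg _) (norm_pow_mul_exp_le_one (hQ z hz) hk)).trans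
      (hgC z hz)
  simpa using norm_coeff_taylorSeries_le one_pos hdiff hbound n

end HarmonicMajorant

section LinearIndependence

theorem linearIndependent_pow_of_transcendental {R A : Type*} [CommRing R] [CommRing A]
    [Algebra R A] {a : A} (ha : Transcendental R a) : LinearIndependent R fun k : ℕ => a ^ k := by
  have hmap := (Polynomial.basisMonomials R).linearIndependent.map'
    (Polynomial.aeval a).toLinearMap (LinearMap.ker_eq_bot.2 (transcendental_iff_injective.1 ha))
  have hcomp : (Polynomial.aeval a).toLinearMap ∘ Polynomial.basisMonomials R =
      fun k => a ^ k := by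
    ext k
    simp [Polynomial.aeval_monomial]
  rwa [hcomp] at hmap

theorem linearIndependent_mul_pow_of_adjoin {K L ι : Type*} [Field K] [Field L] [Algebra K L]
    {y : L} (hy : Transcendental K y) {g : ι → L}
    (hg : LinearIndependent (IntermediateField.adjoin K {y}) g) :
    LinearIndependent K fun ik : ι × ℕ => g ik.1 * y ^ ik.2 := by
  have hgen : Transcendental K (IntermediateField.AdjoinSimple.gen K y) :=
    fun h => hy (h.algHom (IntermediateField.adjoin K {y}).val)
  have hsmul := (linearIndependent_smul (linearIndependent_pow_of_transcendental hgen) hg).comp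
    Prod.swap Prod.swap_injective
  have hcomp : (fun ki : ℕ × ι => IntermediateField.AdjoinSimple.gen K y ^ ki.1 • g ki.2) ∘
      Prod.swap = fun ik => g ik.1 * y ^ ik.2 := by
    ext ik
    exact mul_comm _ _
  rwa [hcomp] at hsmul

theorem linearIndependent_mul_pow_of_algHom {K A L ι : Type*} [Field K] [CommRing A] [Algebra K A]
    [Field L] [Algebra K L] {ψ : A →ₐ[K] L} (hψ : Function.Injective ψ) {a : A}
    (ha : Transcendental K a) {f : ι → A}
    (hf : LinearIndependent (IntermediateField.adjoin K {ψ a}) fun i => ψ (f i)) :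
    LinearIndependent K fun ik : ι × ℕ => f ik.1 * a ^ ik.2 := by
  have hψa : Transcendental K (ψ a) := fun h => ha ((isAlgebraic_algHom_iff ψ hψ).1 h)
  refine LinearIndependent.of_comp ψ.toLinearMap ?_
  simpa [Function.comp_def] using linearIndependent_mul_pow_of_adjoin hψa hf

open PowerSeries

theorem transcendental_powerSeries {K : Type*} [Field K] {p : K⟦X⟧}
    (hp : p ∉ Set.range (C : K →+* K⟦X⟧)) : Transcendental K p := by
  intro halg
  have hr : p - C (constantCoeff p) ≠ 0 := fun h => hp ⟨_, (sub_eq_zero.1 h).symm⟩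
  have hralg : IsAlgebraic K (p - C (constantCoeff p)) :=
    halg.sub (isAlgebraic_algebraMap (constantCoeff p))
  obtain ⟨P, hP0, hP⟩ :=
    hralg.exists_nonzero_coeff_and_aeval_eq_zero (mem_nonZeroDivisors_of_ne_zero hr)
  apply hP0
  have hconst := congrArg (constantCoeff (R := K)) hP
  rw [Polynomial.aeval_def, Polynomial.hom_eval₂] at hconst
  simpa [Polynomial.eval₂_at_zero, PowerSeries.algebraMap_apply] using hconst

end LinearIndependence

section HolonomyBound

open PowerSeries Metric Real

theorem HasIntegerCoeffs.mul {F G : ℚ⟦X⟧} (hF : HasIntegerCoeffs F) (hG : HasIntegerCoeffs G) :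
    HasIntegerCoeffs (F * G) := by
  obtain ⟨F, rfl⟩ := hF.exists_map_eq
  obtain ⟨G, rfl⟩ := hG.exists_map_eq
  exact fun n => ⟨coeff n (F * G), by rw [← map_mul, coeff_map]; rfl⟩

theorem HasIntegerCoeffs.pow {F : ℚ⟦X⟧} (hF : HasIntegerCoeffs F) (k : ℕ) :
    HasIntegerCoeffs (F ^ k) := by
  obtain ⟨F, rfl⟩ := hF.exists_map_eq
  exact fun n => ⟨coeff n (F ^ k), by rw [← map_pow, coeff_map]; rfl⟩

variable {ι : Type*} [Fintype ι] {p x : ℚ⟦X⟧} {φ : ℂ⟦X⟧} {q : ℂ → ℂ} {f : ι → ℚ⟦X⟧}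

theorem card_mul_log_le_of_posLog_le_re (hx0 : constantCoeff x = 0) (hx1 : coeff 1 x = 1)
    (hpx : HasIntegerCoeffs (p.subst x)) (hφ0 : constantCoeff φ = 0) (hφ1 : 1 ≤ ‖coeff 1 φ‖)
    (hq : AnalyticOnNhd ℂ q (closedBall 0 1)) (hqp : taylorSeries q = p.subst φ)
    (hf : LinearIndependent ℚ fun ik : ι × ℕ => f ik.1 * p ^ ik.2)
    (hfx : ∀ i, HasIntegerCoeffs ((f i).subst x))
    (hfφ : ∀ i, IsHolomorphicOnClosedDisc ((f i).subst φ)) {Q : Polynomial ℂ}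
    (hQ : ∀ z ∈ sphere (0 : ℂ) 1, posLog ‖q z‖ ≤ (Q.eval z).re) :
    Fintype.card ι * log ‖coeff 1 φ‖ ≤ exp 1 * (Q.eval 0).re := by
  have hxs := HasSubst.of_constantCoeff_zero' hx0
  have hφs := HasSubst.of_constantCoeff_zero' hφ0
  have hQ0 : 0 ≤ (Q.eval 0).re := by
    rw [← circleAverage_re_eval Q 0 1]
    refine circleAverage_nonneg_of_nonneg fun z hz => posLog_nonneg.trans (hQ z ?_)
    rwa [abs_one] at hz
  choose g hg hgφ using hfφ
  choose B hB using fun i => (isCompact_sphere (0 : ℂ) 1).exists_bound_of_continuousOn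
    ((hg i).continuousOn.mono sphere_subset_closedBall)
  refine card_mul_log_le_exp_one_mul hf hx0 hx1 (fun ik => ?_) hφ0 hφ1 hQ0
    (W := fun D => taylorSeries fun z => Complex.exp (-(D * Q.eval z))) (fun D => ?_)
    (C := ∑ i, |B i|) fun D i k n hk => ?_
  · rw [subst_mul hxs, subst_pow hxs]
    exact (hfx ik.1).mul (hpx.pow ik.2)
  · rw [constantCoeff_taylorSeries, Complex.norm_exp]
    simp
  · rw [subst_mul hφs, subst_pow hφs, ← hgφ, ← hqp]
    refine norm_coeff_mul_pow_mul_taylorSeries_exp_le (hg i) (fun z hz => ?_) hq hQ hk.le n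
    calc ‖g i z‖ ≤ |B i| := (hB i z hz).trans (le_abs_self _)
      _ ≤ ∑ i, |B i| := Finset.single_le_sum (f := fun i => |B i|)
          (fun _ _ => abs_nonneg _) (Finset.mem_univ i)

theorem card_mul_log_le_circleAverage (hp : p ∉ Set.range (C : ℚ →+* ℚ⟦X⟧))
    (hx0 : constantCoeff x = 0) (hx1 : coeff 1 x = 1) (hpx : HasIntegerCoeffs (p.subst x))
    (hφ0 : constantCoeff φ = 0) (hφ1 : 1 ≤ ‖coeff 1 φ‖)
    (hq : AnalyticOnNhd ℂ q (closedBall 0 1)) (hqp : taylorSeries q = p.subst φ)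
    (hf : LinearIndependent (IntermediateField.adjoin ℚ {(p : ℚ⸨X⸩)}) fun i => (f i : ℚ⸨X⸩))
    (hfx : ∀ i, HasIntegerCoeffs ((f i).subst x))
    (hfφ : ∀ i, IsHolomorphicOnClosedDisc ((f i).subst φ)) :
    Fintype.card ι * log ‖coeff 1 φ‖ ≤
      exp 1 * circleAverage (fun z => posLog ‖q z‖) 0 1 := by
  have hindep : LinearIndependent ℚ fun ik : ι × ℕ => f ik.1 * p ^ ik.2 :=
    linearIndependent_mul_pow_of_algHom (ψ := (HahnSeries.ofPowerSeries ℤ ℚ).toRatAlgHom)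
      HahnSeries.ofPowerSeries_injective (transcendental_powerSeries hp) hf
  have hcont : ContinuousOn (fun z => posLog ‖q z‖) (sphere 0 1) :=
    continuous_posLog.comp_continuousOn (hq.continuousOn.mono sphere_subset_closedBall).norm
  refine le_of_forall_pos_le_add fun ε hε => ?_
  obtain ⟨Q, hQ, hQ0⟩ := exists_polynomial_re_majorant hcont (div_pos hε (exp_pos 1))
  calc Fintype.card ι * log ‖coeff 1 φ‖ ≤ exp 1 * (Q.eval 0).re :=
        card_mul_log_le_of_posLog_le_re hx0 hx1 hpx hφ0 hφ1 hq hqp hindep hfx hfφ hQ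
    _ ≤ exp 1 * (circleAverage (fun z => posLog ‖q z‖) 0 1 + ε / exp 1) := by gcongr
    _ = exp 1 * circleAverage (fun z => posLog ‖q z‖) 0 1 + ε := by field_simp

theorem isAlgebraic_of_isHolomorphicOnClosedDisc (hp : p ∉ Set.range (C : ℚ →+* ℚ⟦X⟧))
    (hx0 : constantCoeff x = 0) (hx1 : coeff 1 x = 1) (hpx : HasIntegerCoeffs (p.subst x))
    (hφ0 : constantCoeff φ = 0) (hφ1 : 1 < ‖coeff 1 φ‖)
    (hq : AnalyticOnNhd ℂ q (closedBall 0 1)) (hqp : taylorSeries q = p.subst φ) {g : ℚ⟦X⟧}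
    (hgx : HasIntegerCoeffs (g.subst x)) (hgφ : IsHolomorphicOnClosedDisc (g.subst φ)) :
    IsAlgebraic (IntermediateField.adjoin ℚ {(p : ℚ⸨X⸩)}) (g : ℚ⸨X⸩) := by
  by_contra htr
  obtain ⟨M, hM⟩ := exists_lt_nsmul (log_pos hφ1)
    (exp 1 * circleAverage (fun z => posLog ‖q z‖) 0 1)
  have hindep : LinearIndependent (IntermediateField.adjoin ℚ {(p : ℚ⸨X⸩)})
      fun k : Fin M => ((g ^ (k : ℕ) : ℚ⟦X⟧) : ℚ⸨X⸩) := by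
    simp only [map_pow]
    exact (linearIndependent_pow_of_transcendental htr).comp Fin.val Fin.val_injective
  have hbound := card_mul_log_le_circleAverage hp hx0 hx1 hpx hφ0 hφ1.le hq hqp hindep
    (fun k => by rw [subst_pow (.of_constantCoeff_zero' hx0)]; exact hgx.pow k)
    fun k => by rw [subst_pow (.of_constantCoeff_zero' hφ0)]; exact hgφ.pow k
  rw [Fintype.card_fin, ← nsmul_eq_mul] at hbound
  exact hM.not_ge hbound

theorem theorem2p1_general (hp : p ∉ Set.range (C : ℚ →+* ℚ⟦X⟧))
    (hx0 : constantCoeff x = 0) (hx1 : coeff 1 x = 1) (hpx : HasIntegerCoeffs (p.subst x))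
    (hφ0 : constantCoeff φ = 0) (hφ1 : 1 < ‖coeff 1 φ‖)
    (hq : AnalyticOnNhd ℂ q (closedBall 0 1)) (hqp : taylorSeries q = p.subst φ)
    (hf : LinearIndependent (IntermediateField.adjoin ℚ {(p : ℚ⸨X⸩)}) fun i => (f i : ℚ⸨X⸩))
    (hfx : ∀ i, HasIntegerCoeffs ((f i).subst x))
    (hfφ : ∀ i, IsHolomorphicOnClosedDisc ((f i).subst φ)) :
    (∀ i, IsAlgebraic (IntermediateField.adjoin ℚ {(p : ℚ⸨X⸩)}) (f i : ℚ⸨X⸩)) ∧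
      (Fintype.card ι : ℝ) ≤
        exp 1 * (circleAverage (fun z => posLog ‖q z‖) 0 1 / log ‖coeff 1 φ‖) := by
  refine ⟨fun i => isAlgebraic_of_isHolomorphicOnClosedDisc hp hx0 hx1 hpx hφ0 hφ1 hq hqp (hfx i)
    (hfφ i), ?_⟩
  rw [mul_div_assoc', le_div_iff₀ (log_pos hφ1)]
  exact card_mul_log_le_circleAverage hp hx0 hx1 hpx hφ0 hφ1.le hq hqp hf hfx hfφ

end HolonomyBound

section RationalFunctions

open PowerSeries

variable {K : Type*} [Field K]

/-- The expansion at `0` of a rational function `p`, obtained by inverting the denominator in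
`K⟦X⟧`. It is meaningful only when `p` has no pole at `0`: otherwise the inverse is `0`. -/
noncomputable def ratSeries (p : RatFunc K) : K⟦X⟧ :=
  (p.num : K⟦X⟧) * (p.denom : K⟦X⟧)⁻¹

variable {p : RatFunc K}

theorem ratSeries_mul_denom (hp0 : p.denom.eval 0 ≠ 0) :
    ratSeries p * (p.denom : K⟦X⟧) = (p.num : K⟦X⟧) := by
  rw [ratSeries, mul_assoc, PowerSeries.inv_mul_cancel, mul_one]
  rwa [Polynomial.constantCoeff_coe, Polynomial.coeff_zero_eq_eval_zero]

theorem coe_ratFunc_eq_num_div_denom (p : RatFunc K) :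
    (p : K⸨X⸩) = ((p.num : K⟦X⟧) : K⸨X⸩) / ((p.denom : K⟦X⟧) : K⸨X⸩) := by
  rw [RatFunc.coe_coe, RatFunc.coe_coe, ← map_div₀]
  exact congrArg _ (RatFunc.num_div_denom p).symm

theorem coe_ratSeries (hp0 : p.denom.eval 0 ≠ 0) : (ratSeries p : K⸨X⸩) = (p : K⸨X⸩) := by
  have hdenom : ((p.denom : K⟦X⟧) : K⸨X⸩) ≠ 0 := by
    rw [Ne, map_eq_zero_iff _ HahnSeries.ofPowerSeries_injective, Polynomial.coe_eq_zero_iff]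
    exact p.denom_ne_zero
  rw [coe_ratFunc_eq_num_div_denom, eq_div_iff hdenom, ← map_mul, ratSeries_mul_denom hp0]

theorem ratSeries_notMem_range_C (hp : p ∉ Set.range (RatFunc.C : K →+* RatFunc K))
    (hp0 : p.denom.eval 0 ≠ 0) : ratSeries p ∉ Set.range (C : K →+* K⟦X⟧) := by
  rintro ⟨c, hc⟩
  have hcoe : ((RatFunc.C c : RatFunc K) : K⸨X⸩) = (p : K⸨X⸩) := by
    rw [← coe_ratSeries hp0, ← hc, ← Polynomial.coe_C, RatFunc.coe_coe]
    exact congrArg _ (RatFunc.algebraMap_C c).symm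
  exact hp ⟨c, RingHom.injective _ hcoe⟩

section Subst

variable {R : Type*} [CommRing R] [Algebra K R] {a : R⟦X⟧}

theorem subst_ratSeries_mul (hp0 : p.denom.eval 0 ≠ 0) (ha : constantCoeff a = 0) :
    (ratSeries p).subst a * Polynomial.aeval a p.denom = Polynomial.aeval a p.num := by
  have hs : HasSubst a := .of_constantCoeff_zero' ha
  rw [← subst_coe hs, ← subst_coe hs, ← ratSeries_mul_denom hp0, subst_mul hs]

theorem aeval_denom_ne_zero [Nontrivial R] (hp0 : p.denom.eval 0 ≠ 0)
    (ha : constantCoeff a = 0) : Polynomial.aeval a p.denom ≠ 0 := by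
  intro h
  have hconst := congrArg (constantCoeff (R := R)) h
  rw [Polynomial.aeval_def, Polynomial.hom_eval₂, ha, map_zero, Polynomial.eval₂_at_zero,
    Polynomial.coeff_zero_eq_eval_zero, RingHom.comp_apply, PowerSeries.algebraMap_apply,
    constantCoeff_C] at hconst
  exact hp0 ((map_eq_zero_iff _ (algebraMap K R).injective).1 hconst)

end Subst

theorem taylorSeries_eval_ratFunc {p : RatFunc ℚ} (hp0 : p.denom.eval 0 ≠ 0) {φ : ℂ → ℂ}
    (hφ : AnalyticAt ℂ φ 0) (hφ0 : φ 0 = 0)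
    (hpφ : AnalyticAt ℂ (fun z => RatFunc.eval (algebraMap ℚ ℂ) (φ z) p) 0) :
    taylorSeries (fun z => RatFunc.eval (algebraMap ℚ ℂ) (φ z) p) =
      (ratSeries p).subst (taylorSeries φ) := by
  have hc : constantCoeff (taylorSeries φ) = 0 := by rw [constantCoeff_taylorSeries, hφ0]
  have hdenom : AnalyticAt ℂ (fun z => Polynomial.aeval (φ z) p.denom) 0 :=
    hφ.aeval_polynomial p.denom
  have hdenom0 : Polynomial.aeval (φ 0) p.denom ≠ 0 := by
    rw [hφ0, Polynomial.aeval_def, Polynomial.eval₂_at_zero, Polynomial.coeff_zero_eq_eval_zero]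
    simpa using hp0
  refine mul_right_cancel₀ (aeval_denom_ne_zero hp0 hc) ?_
  rw [subst_ratSeries_mul hp0 hc, ← taylorSeries_aeval hφ, ← taylorSeries_aeval hφ,
    ← taylorSeries_mul hpφ hdenom]
  refine taylorSeries_congr ?_
  filter_upwards [hdenom.continuousAt.eventually_ne hdenom0] with z hz
  exact div_mul_cancel₀ _ hz

theorem coe_aeval_laurentSeries (x : ℚ⟦X⟧) (Q : Polynomial ℚ) :
    ((Polynomial.aeval x Q : ℚ⟦X⟧) : ℚ⸨X⸩) = Polynomial.aeval (x : ℚ⸨X⸩) Q :=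
  (Polynomial.aeval_algHom_apply (HahnSeries.ofPowerSeries ℤ ℚ).toRatAlgHom x Q).symm

theorem subst_ratSeries_eq {p : RatFunc ℚ} (hp0 : p.denom.eval 0 ≠ 0) {x P : ℚ⟦X⟧}
    (hx : constantCoeff x = 0)
    (hP : (P : ℚ⸨X⸩) = RatFunc.eval (algebraMap ℚ ℚ⸨X⸩) (x : ℚ⸨X⸩) p) :
    (ratSeries p).subst x = P := by
  have hdenom := aeval_denom_ne_zero hp0 hx
  refine mul_right_cancel₀ hdenom (HahnSeries.ofPowerSeries_injective (Γ := ℤ) ?_)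
  rw [subst_ratSeries_mul hp0 hx, map_mul, hP, RatFunc.eval,
    ← Polynomial.aeval_def, ← Polynomial.aeval_def, ← coe_aeval_laurentSeries,
    ← coe_aeval_laurentSeries, div_mul_cancel₀]
  rwa [Ne, map_eq_zero_iff _ HahnSeries.ofPowerSeries_injective]

theorem coe_polynomial_mem_adjoin_X (Q : Polynomial ℚ) : ((Q : ℚ⟦X⟧) : ℚ⸨X⸩) ∈
    IntermediateField.adjoin ℚ {((X : ℚ⟦X⟧) : ℚ⸨X⸩)} := by
  have haeval : (Q : ℚ⟦X⟧) = Polynomial.aeval X Q := (Q.eval₂_C_X_eq_coe).symm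
  rw [haeval, coe_aeval_laurentSeries]
  exact IntermediateField.algebra_adjoin_le_adjoin _ _ (Polynomial.aeval_mem_adjoin_singleton _ _)

theorem coe_ratFunc_mem_adjoin_X (p : RatFunc ℚ) : (p : ℚ⸨X⸩) ∈
    IntermediateField.adjoin ℚ {((X : ℚ⟦X⟧) : ℚ⸨X⸩)} := by
  rw [coe_ratFunc_eq_num_div_denom]
  exact div_mem (coe_polynomial_mem_adjoin_X _) (coe_polynomial_mem_adjoin_X _)

end RationalFunctions

theorem theorem2p1
    -- a nonconstant rational function without pole at `0`
    (p : RatFunc ℚ) (hp : p ∉ Set.range (RatFunc.C : ℚ →+* RatFunc ℚ))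
    (hp0 : p.denom.eval 0 ≠ 0)
    -- `x(t) ∈ t + t²ℚ⟦t⟧` with `p(x(t)) ∈ ℤ⟦t⟧`, where `p(x(t))` is evaluated in the field `ℚ⸨t⸩`
    (x : ℚ⟦X⟧) (hx0 : PowerSeries.coeff 0 x = 0) (hx1 : PowerSeries.coeff 1 x = 1)
    (hpx : ∃ P : ℚ⟦X⟧, HasIntegerCoeffs P ∧
      (P : ℚ⸨X⸩) = RatFunc.eval (algebraMap ℚ ℚ⸨X⸩) (x : ℚ⸨X⸩) p)
    -- `φ`, holomorphic near the closed unit disc, with `p ∘ φ` holomorphic there as well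
    -- (analyticity forces `φ` to avoid the poles of `p`)
    (φ : ℂ → ℂ) (hφ : AnalyticOnNhd ℂ φ (Metric.closedBall 0 1)) (hφ0 : φ 0 = 0)
    (hφ1 : 1 < ‖deriv φ 0‖)
    (hpφ : AnalyticOnNhd ℂ (fun z => RatFunc.eval (algebraMap ℚ ℂ) (φ z) p)
      (Metric.closedBall 0 1))
    -- `f₁, …, f_m`, linearly independent over the field `ℚ(p(x)) ⊆ ℚ⸨x⸩`
    (m : ℕ) (f : Fin m → ℚ⟦X⟧)
    (hf : LinearIndependent (IntermediateField.adjoin ℚ {(p : ℚ⸨X⸩)})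
      (fun i => (f i : ℚ⸨X⸩)))
    (hfx : ∀ i, HasIntegerCoeffs (PowerSeries.subst x (f i)))
    (hfφ : ∀ i, IsHolomorphicOnClosedDisc (PowerSeries.subst (taylorSeries φ) (f i))) :
    -- algebraicity over the field `ℚ(x) ⊆ ℚ⸨x⸩`, and the bound on `m`
    (∀ i, IsAlgebraic (IntermediateField.adjoin ℚ {((PowerSeries.X : ℚ⟦X⟧) : ℚ⸨X⸩)})
        (f i : ℚ⸨X⸩)) ∧
      (m : ℝ) ≤ Real.exp 1 *
        (Real.circleAverage (fun z => Real.posLog ‖RatFunc.eval (algebraMap ℚ ℂ) (φ z) p‖) 0 1 /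
          Real.log ‖deriv φ 0‖) := by
  obtain ⟨P, hP, hPp⟩ := hpx
  have hx0' : PowerSeries.constantCoeff x = 0 := by simpa using hx0
  have h0 : (0 : ℂ) ∈ Metric.closedBall (0 : ℂ) 1 := by simp
  obtain ⟨halg, hcard⟩ := theorem2p1_general (p := ratSeries p) (ratSeries_notMem_range_C hp hp0)
    hx0' hx1 (by rwa [subst_ratSeries_eq hp0 hx0' hPp])
    (by rw [constantCoeff_taylorSeries, hφ0]) (by rwa [coeff_one_taylorSeries]) hpφ
    (taylorSeries_eval_ratFunc hp0 (hφ 0 h0) hφ0 (hpφ 0 h0)) (by rwa [coe_ratSeries hp0]) hfx hfφ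
  rw [coe_ratSeries hp0] at halg
  rw [Fintype.card_fin, coeff_one_taylorSeries] at hcard
  have hadjoin := IntermediateField.adjoin_simple_le_iff.2 (coe_ratFunc_mem_adjoin_X p)
  exact ⟨fun i => (halg i).tower_top_of_subalgebra_le hadjoin, hcard⟩
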